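/- Let $b_1,\dots,b_K$ ($K\ge 1$) be arms, where $b_i$ beats $b_j$ in a duel with probability $\tfrac12+\phi(b_i,b_j)$, with $\phi(b_i,b_j)=-\phi(b_j,b_i)\in[-\tfrac12,\tfrac12]$; write $b_i\succ b_j$ if $\phi(b_i,b_j)>0$, and assume that the arms are totally ordered: $b_i\succ b_j\iff i<j$. Assume Approximate Linearity: there is a constant $\gamma>0$ with $$\phi(b_i,b_k)-\phi(b_j,b_k)\ \ge\ \gamma\,\phi(b_i,b_j)\qquad\text{whenever } b_i\succ b_j\succ b_k .$$ A player repeatedly duels $n\ge 1$ opponent arms ($n=1$ is the ordinary two-player setting), using Beta–Bernoulli Thompson sampling: in round $t$, given the past, he draws independent samples $\theta_i\sim\mathrm{Beta}(S_i+1,F_i+1)$, $i=1,\dots,K$, where $S_i$ and $F_i$ are the numbers of duels that he has won and lost with arm $b_i$ in the earlier rounds, and plays an arm $b_t$ with the largest $\theta_i$. Given the past and the player's arm, the tuple of the $n$ opponent arms is drawn from a distribution $D_t$ on $\{b_1,\dots,b_K\}^n$, which may change from round to round and may depend on the past. Given the past and the arms of the round, each duel between the player's arm $b$ and an opponent arm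 $b'$ is won by the player with probability $\tfrac12+\phi(b,b')$, and he observes the outcomes of his duels. If, almost surely, $D_t$ converges as $t\to\infty$ to a (possibly random) distribution $D$, then the player converges to the optimal arm (one-side convergence): $$\lim_{t\to\infty}\mathbb P(b_t=b_1)=1 .$$ -/

import Mathlib

open MeasureTheory ProbabilityTheory Filter Topology

noncomputable section

namespace DuelingTS

/-- The stochastic preference function of a dueling bandit problem with arms `0, 1, …, K - 1`
listed from best to worst. Arm `i` beats arm `j` with probability `φ i j + 1 / 2`. -/
structure IsPreference {K : ℕ} (φ : Fin K → Fin K → ℝ) : Prop where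
  /-- `φ i j + 1 / 2` is a probability. -/
  mem_Icc : ∀ i j, φ i j ∈ Set.Icc (-(1 / 2) : ℝ) (1 / 2)
  /-- Exactly one of the two arms wins a duel. -/
  skew : ∀ i j, φ i j = -φ j i
  /-- The arms are totally ordered, `b_i ≻ b_j` (that is `0 < φ i j`) if and only if `i < j`. -/
  pos_iff_lt : ∀ i j, 0 < φ i j ↔ i < j

/-- Approximate Linearity: for some constant `γ > 0` and every triplet `b_i ≻ b_j ≻ b_k`,
`φ(b_i, b_k) - φ(b_j, b_k) ≥ γ φ(b_i, b_j)`. -/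
def ApproximateLinearity {K : ℕ} (φ : Fin K → Fin K → ℝ) : Prop :=
  ∃ γ : ℝ, 0 < γ ∧ ∀ i j k, 0 < φ i j → 0 < φ j k → φ i k - φ j k ≥ γ * φ i j

variable {Ω : Type*} {K n : ℕ}

/-- The number `S_i` of duels won with arm `i` in the rounds before `t`, where `I s` is the arm
played in round `s` and `X s k` says whether the duel with the `k`-th opponent was won. -/
def wins (I : ℕ → Ω → Fin K) (X : ℕ → Ω → Fin n → Bool) (i : Fin K) (t : ℕ) (ω : Ω) : ℕ :=
  ∑ s ∈ Finset.range t, ∑ k : Fin n, if I s ω = i ∧ X s ω k = true then 1 else 0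

/-- The number `F_i` of duels lost with arm `i` in the rounds before `t`. -/
def losses (I : ℕ → Ω → Fin K) (X : ℕ → Ω → Fin n → Bool) (i : Fin K) (t : ℕ) (ω : Ω) : ℕ :=
  ∑ s ∈ Finset.range t, ∑ k : Fin n, if I s ω = i ∧ X s ω k = false then 1 else 0

/-- The sampling distribution of Thompson sampling in round `t`: independently for each arm `i`,
the distribution `Beta (S_i + 1, F_i + 1)`. -/
def posterior (I : ℕ → Ω → Fin K) (X : ℕ → Ω → Fin n → Bool) (t : ℕ) (ω : Ω) :
    Measure (Fin K → ℝ) :=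
  Measure.pi fun i => betaMeasure ((wins I X i t ω : ℝ) + 1) ((losses I X i t ω : ℝ) + 1)

/-- One player runs Beta-Bernoulli Thompson sampling and duels, in each round `t = 0, 1, 2, …`,
`n` opponent arms, drawn from a (possibly random, history dependent) distribution `D t`.
`ℱ t` is the information available before round `t`, `θ t` the vector of samples, `I t` the
player's arm, `O t` the opponent arms, and `X t k` tells if the duel with `O t k` was won. -/
structure IsThompsonPlay [mΩ : MeasurableSpace Ω] (P : Measure Ω) (φ : Fin K → Fin K → ℝ)
    (ℱ : Filtration ℕ mΩ) (θ : ℕ → Ω → Fin K → ℝ) (I : ℕ → Ω → Fin K)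
    (O : ℕ → Ω → Fin n → Fin K) (X : ℕ → Ω → Fin n → Bool)
    (D : ℕ → Ω → PMF (Fin n → Fin K)) : Prop where
  measurable_sample : ∀ t, Measurable (θ t)
  measurable_arm : ∀ t, Measurable[ℱ (t + 1)] (I t)
  measurable_opponents : ∀ t, Measurable[ℱ (t + 1)] (O t)
  measurable_outcome : ∀ t, Measurable[ℱ (t + 1)] (X t)
  /-- The opponents' distribution in round `t` is determined by what happened before. -/
  measurable_dist : ∀ t o, Measurable[ℱ t] fun ω => D t ω o
  /-- Given the past, the samples are independent, `θ_i ∼ Beta (S_i + 1, F_i + 1)`. -/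
  sample_law : ∀ t, ∀ A : Set (Fin K → ℝ), MeasurableSet A →
    P⟦θ t ⁻¹' A | ℱ t⟧ =ᵐ[P] fun ω => (posterior I X t ω).real A
  /-- The player plays an arm with the largest sample (ties may be broken in any way). -/
  arm_argmax : ∀ t ω i, θ t ω i ≤ θ t ω (I t ω)
  /-- Given the past and the player's arm, the opponent arms have distribution `D t`. -/
  opponents_law : ∀ t o,
    P⟦O t ⁻¹' {o} | (ℱ t : MeasurableSpace Ω) ⊔ MeasurableSpace.comap (I t) inferInstance⟧
      =ᵐ[P] fun ω => (D t ω o).toReal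
  /-- Given the past and all arms of the round, the player's arm wins each of its duels with the
  probability given by `φ` (duels of one round need not even be independent of each other). -/
  outcome_law : ∀ t k,
    P⟦{ω | X t ω k = true} | (ℱ t : MeasurableSpace Ω) ⊔
        MeasurableSpace.comap (fun ω => (I t ω, O t ω)) inferInstance⟧
      =ᵐ[P] fun ω => φ (I t ω) (O t ω k) + 1 / 2

end DuelingTS

end

/-! Against every opponent `k`, the best arm wins more often than any other arm `j`, by a margin
that depends neither on `j` nor on `k` (`DuelingTS.exists_gap`). So, whatever distribution `q` the
opponents' choices converge to, the winning rate of the best arm against `q` exceeds that of every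
other arm by this margin. What remains is a bandit problem whose rewards are only asymptotically
stationary.

The empirical winning rate of an arm that is played infinitely often converges to its winning rate
against the limit distribution (`DuelingTS.IsThompsonPlay.ae_isLittleO_wins`). This is a law of
large numbers with a random clock, `DuelingTS.ae_isLittleO_sum`, obtained from nonnegative
exponential supermartingales: they converge, hence are bounded, and so the underlying martingale is
at most a small multiple of its clock. By Chebyshev's inequality the beta posterior of such an arm
concentrates at that winning rate, while the posterior of an arm that is played finitely often is
eventually frozen and charges every subinterval of `(0, 1)`.

If the best arm were played finitely often, its frozen posterior would give it a conditional
probability of being played bounded below, since the other winning rates stay away from `1`; by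
Lévy's conditional Borel–Cantelli lemma it would be played infinitely often after all. Hence the
best arm is played infinitely often. The conditional probability of playing a suboptimal arm
therefore tends to `0` almost surely: if that arm is played infinitely often, both posteriors
concentrate, at different values; if not, its conditional probabilities are summable by
Borel–Cantelli (`DuelingTS.IsThompsonPlay.ae_tendsto_condProb_arm`). Dominated convergence removes
the conditioning. -/

namespace DuelingTS

/-! ### Concentration and support of beta distributions -/

section Beta

lemma beta_add_one_left {a b : ℝ} (ha : 0 < a) (hb : 0 < b) :
    beta (a + 1) b = a / (a + b) * beta a b := by
  have hab : 0 < a + b := by positivity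
  have h2 : a + 1 + b = a + b + 1 := by ring
  have hG := (Real.Gamma_pos_of_pos hab).ne'
  rw [beta, beta, h2, Real.Gamma_add_one ha.ne', Real.Gamma_add_one hab.ne']
  field_simp

/-- Multiplying a beta density by its variable shifts the first parameter; this is what makes all
moments of the beta distribution explicit. -/
lemma betaPDFReal_mul_self {a b : ℝ} (ha : 0 < a) (hb : 0 < b) (x : ℝ) :
    betaPDFReal a b x * x = a / (a + b) * betaPDFReal (a + 1) b x := by
  unfold betaPDFReal
  split_ifs with hx
  · have hB := (beta_pos ha hb).ne'
    have hab : 0 < a + b := by positivity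
    rw [beta_add_one_left ha hb, show a + 1 - 1 = (a - 1) + 1 by ring,
      Real.rpow_add_one hx.1.ne']
    field_simp
  · simp

lemma betaPDFReal_nonneg {a b : ℝ} (ha : 0 < a) (hb : 0 < b) (x : ℝ) :
    0 ≤ betaPDFReal a b x := by
  by_cases hx : 0 < x ∧ x < 1
  · exact (betaPDFReal_pos hx.1 hx.2 ha hb).le
  · simp [betaPDFReal, hx]

lemma integrable_betaPDFReal {a b : ℝ} (ha : 0 < a) (hb : 0 < b) :
    Integrable (betaPDFReal a b) := by
  refine ⟨(measurable_betaPDFReal a b).aestronglyMeasurable, ?_⟩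
  rw [hasFiniteIntegral_iff_ofReal (ae_of_all _ (betaPDFReal_nonneg ha hb))]
  change ∫⁻ x, betaPDF a b x < ⊤
  rw [lintegral_betaPDF_eq_one ha hb]
  exact ENNReal.one_lt_top

lemma integral_betaPDFReal {a b : ℝ} (ha : 0 < a) (hb : 0 < b) :
    ∫ x, betaPDFReal a b x = 1 := by
  rw [integral_eq_lintegral_of_nonneg_ae (ae_of_all _ (betaPDFReal_nonneg ha hb))
    (measurable_betaPDFReal a b).aestronglyMeasurable]
  change (∫⁻ x, betaPDF a b x).toReal = 1
  rw [lintegral_betaPDF_eq_one ha hb, ENNReal.toReal_one]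

/-- The second moment of `Beta (a, b)` about the point `p`. -/
noncomputable def betaSecondMoment (a b p : ℝ) : ℝ :=
  a / (a + b) * ((a + 1) / (a + 1 + b)) - 2 * p * (a / (a + b)) + p ^ 2

lemma betaPDFReal_mul_sq {a b : ℝ} (ha : 0 < a) (hb : 0 < b) (p x : ℝ) :
    betaPDFReal a b x * (x - p) ^ 2 =
      a / (a + b) * ((a + 1) / (a + 1 + b)) * betaPDFReal (a + 1 + 1) b x
        - 2 * p * (a / (a + b)) * betaPDFReal (a + 1) b x + p ^ 2 * betaPDFReal a b x := by
  have h1 := betaPDFReal_mul_self ha hb x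
  have h2 := betaPDFReal_mul_self (a := a + 1) (by positivity) hb x
  linear_combination (x - 2 * p) * h1 + a / (a + b) * h2

lemma integrable_betaPDFReal_mul_sq {a b : ℝ} (ha : 0 < a) (hb : 0 < b) (p : ℝ) :
    Integrable fun x => betaPDFReal a b x * (x - p) ^ 2 := by
  simp_rw [betaPDFReal_mul_sq ha hb]
  exact (((integrable_betaPDFReal (by positivity) hb).const_mul _).sub
    ((integrable_betaPDFReal (by positivity) hb).const_mul _)).add
    ((integrable_betaPDFReal ha hb).const_mul _)

lemma integral_betaPDFReal_mul_sq {a b : ℝ} (ha : 0 < a) (hb : 0 < b) (p : ℝ) :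
    ∫ x, betaPDFReal a b x * (x - p) ^ 2 = betaSecondMoment a b p := by
  simp_rw [betaPDFReal_mul_sq ha hb]
  have i1 := (integrable_betaPDFReal (a := a + 1) (by positivity) hb).const_mul
    (2 * p * (a / (a + b)))
  have i2 := (integrable_betaPDFReal (a := a + 1 + 1) (by positivity) hb).const_mul
    (a / (a + b) * ((a + 1) / (a + 1 + b)))
  have i3 := (integrable_betaPDFReal ha hb).const_mul (p ^ 2)
  rw [integral_add (by exact i2.sub i1) i3, integral_sub i2 i1, integral_const_mul,
    integral_const_mul, integral_const_mul, integral_betaPDFReal ha hb,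
    integral_betaPDFReal (by positivity) hb, integral_betaPDFReal (by positivity) hb, betaSecondMoment]
  ring

/-- Chebyshev's inequality for the beta distribution. -/
lemma betaMeasure_real_le {a b : ℝ} (ha : 0 < a) (hb : 0 < b) (p : ℝ) {ε : ℝ} (hε : 0 < ε) :
    (betaMeasure a b).real {x | ε ≤ |x - p|} ≤ betaSecondMoment a b p / ε ^ 2 := by
  have hmeas : MeasurableSet {x : ℝ | ε ≤ |x - p|} :=
    measurableSet_le measurable_const (by fun_prop)
  have hnn : ∀ x, 0 ≤ betaPDFReal a b x * (x - p) ^ 2 / ε ^ 2 := fun x =>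
    div_nonneg (mul_nonneg (betaPDFReal_nonneg ha hb x) (sq_nonneg _)) (sq_nonneg _)
  have hle : betaMeasure a b {x | ε ≤ |x - p|} ≤
      ENNReal.ofReal (betaSecondMoment a b p / ε ^ 2) := by
    rw [← integral_betaPDFReal_mul_sq ha hb, ← integral_div,
      ofReal_integral_eq_lintegral_ofReal ((integrable_betaPDFReal_mul_sq ha hb p).div_const _)
        (ae_of_all _ hnn), betaMeasure, withDensity_apply _ hmeas]
    refine (setLIntegral_mono' hmeas fun x hx => ?_).trans (setLIntegral_le_lintegral _ _)
    refine ENNReal.ofReal_le_ofReal ?_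
    rw [mul_div_assoc]
    refine le_mul_of_one_le_right (betaPDFReal_nonneg ha hb x) ?_
    rw [one_le_div (by positivity), ← sq_abs (x - p)]
    exact pow_le_pow_left₀ hε.le hx 2
  refine ENNReal.toReal_le_of_le_ofReal ?_ hle
  rw [← integral_betaPDFReal_mul_sq ha hb, ← integral_div]
  exact integral_nonneg hnn

/-- Beta distributions whose means tend to `p` and whose total pseudo-count `a + b` tends
to infinity concentrate at `p`. -/
lemma tendsto_betaMeasure_real {a b : ℕ → ℝ} (ha : ∀ t, 0 < a t) (hb : ∀ t, 0 < b t) {p : ℝ}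
    (hab : Tendsto (fun t => a t + b t) atTop atTop)
    (hp : Tendsto (fun t => a t / (a t + b t)) atTop (𝓝 p)) {ε : ℝ} (hε : 0 < ε) :
    Tendsto (fun t => (betaMeasure (a t) (b t)).real {x | ε ≤ |x - p|}) atTop (𝓝 0) := by
  have hinv : Tendsto (fun t => (a t + b t)⁻¹) atTop (𝓝 0) := tendsto_inv_atTop_zero.comp hab
  have h1 : Tendsto (fun t => (a t + 1) / (a t + 1 + b t)) atTop (𝓝 p) := by
    have : Tendsto (fun t => (a t / (a t + b t) + (a t + b t)⁻¹) / (1 + (a t + b t)⁻¹)) atTop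
        (𝓝 ((p + 0) / (1 + 0))) :=
      (hp.add hinv).div (tendsto_const_nhds.add hinv) (by norm_num)
    simp only [add_zero, div_one] at this
    refine this.congr fun t => ?_
    have := ha t
    have := hb t
    have h3 : 0 < a t + b t := by positivity
    field_simp
    ring
  have h2 : Tendsto (fun t => betaSecondMoment (a t) (b t) p / ε ^ 2) atTop (𝓝 0) := by
    have := (((hp.mul h1).sub (hp.const_mul (2 * p))).add_const (p ^ 2)).div_const (ε ^ 2)
    rwa [show (p * p - 2 * p * p + p ^ 2) / ε ^ 2 = 0 by ring] at this
  exact squeeze_zero (fun t => measureReal_nonneg) (fun t => betaMeasure_real_le (ha t) (hb t) p hε)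
    h2

/-- The beta distributions have full support in the unit interval. -/
lemma betaMeasure_real_Ioo_pos {a b : ℝ} (ha : 0 < a) (hb : 0 < b) {u v : ℝ} (hu : 0 ≤ u)
    (huv : u < v) (hv : v ≤ 1) : 0 < (betaMeasure a b).real (Set.Ioo u v) := by
  have := isProbabilityMeasureBeta ha hb
  refine ENNReal.toReal_pos ?_ (measure_ne_top _ _)
  rw [betaMeasure, withDensity_apply _ measurableSet_Ioo, ← pos_iff_ne_zero,
    setLIntegral_pos_iff (by unfold betaPDF; fun_prop)]
  have hsub : Set.Ioo u v ⊆ (Function.support (betaPDF a b) ∩ Set.Ioo u v) := fun x hx =>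
    ⟨(ENNReal.ofReal_pos.2 (betaPDFReal_pos (hu.trans_lt hx.1) (hx.2.trans_le hv) ha hb)).ne', hx⟩
  refine lt_of_lt_of_le ?_ (measure_mono hsub)
  simpa using huv

end Beta

/-! ### A martingale law of large numbers with a random clock -/

section Martingale

variable {Ω : Type*} {mΩ : MeasurableSpace Ω} {P : Measure Ω} [IsProbabilityMeasure P]

/-- The elementary inequality behind the exponential supermartingale: for `c ≤ 1` and
`|x| ≤ 1`, the variable `exp (c x - c²)` is dominated by an affine function of `x`
that takes the value `1` at `x = 0`. -/
lemma exp_mul_sub_sq_le {c x : ℝ} (hc : 0 ≤ c) (hc1 : c ≤ 1) (hx : |x| ≤ 1) :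
    Real.exp (c * x - c ^ 2) ≤ 1 + c * Real.exp (-c ^ 2) * x := by
  have hcx : |c * x| ≤ 1 := by
    rw [abs_mul, abs_of_nonneg hc]
    exact mul_le_one₀ hc1 (abs_nonneg _) hx
  have h1 := (abs_le.1 (Real.abs_exp_sub_one_sub_id_le hcx)).2
  have h2 : (c * x) ^ 2 ≤ c ^ 2 := by
    rw [mul_pow]
    exact mul_le_of_le_one_right (sq_nonneg c) ((sq_le_one_iff_abs_le_one x).2 hx)
  have h3 : (1 + c ^ 2) * Real.exp (-c ^ 2) ≤ 1 := by
    rw [Real.exp_neg, ← div_eq_mul_inv, div_le_one (Real.exp_pos _), add_comm]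
    exact Real.add_one_le_exp _
  have h4 := Real.exp_pos (-c ^ 2)
  rw [sub_eq_add_neg, Real.exp_add]
  have h5 : Real.exp (c * x) ≤ 1 + c * x + c ^ 2 := by linarith
  nlinarith [mul_le_mul_of_nonneg_right h5 h4.le]

lemma supermartingale_exp {ℱ : Filtration ℕ mΩ} {ξ : ℕ → Ω → ℝ} {A : ℕ → Set Ω}
    (hξ : ∀ s, Measurable[ℱ (s + 1)] (ξ s)) (hA : ∀ s, MeasurableSet[ℱ (s + 1)] (A s))
    (hbound : ∀ s ω, |ξ s ω| ≤ (A s).indicator 1 ω) (hcond : ∀ s, P[ξ s | ℱ s] =ᵐ[P] 0)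
    {c : ℝ} (hc : 0 ≤ c) (hc1 : c ≤ 1) :
    Supermartingale (fun t ω => Real.exp (∑ s ∈ Finset.range t,
      (c * ξ s ω - c ^ 2 * (A s).indicator 1 ω))) ℱ P := by
  have hξ1 : ∀ s ω, |ξ s ω| ≤ 1 := fun s ω =>
    (hbound s ω).trans (Set.indicator_le_self' (by simp) ω)
  have hadp : StronglyAdapted ℱ (fun t ω => Real.exp (∑ s ∈ Finset.range t,
      (c * ξ s ω - c ^ 2 * (A s).indicator 1 ω))) := fun t => by
    refine Measurable.stronglyMeasurable ?_
    refine Real.measurable_exp.comp (Finset.measurable_fun_sum _ fun s hs => ?_)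
    have hst := ℱ.mono (Nat.succ_le_of_lt (Finset.mem_range.1 hs))
    have h1 : Measurable[ℱ t] (ξ s) := (hξ s).mono hst le_rfl
    have h2 : Measurable[ℱ t] ((A s).indicator (1 : Ω → ℝ)) :=
      (stronglyMeasurable_one.indicator (hst _ (hA s))).measurable
    exact (h1.const_mul c).sub (h2.const_mul (c ^ 2))
  have hZ : ∀ t ω, Real.exp (∑ s ∈ Finset.range t,
      (c * ξ s ω - c ^ 2 * (A s).indicator 1 ω)) ≤ Real.exp t := fun t ω => by
    refine Real.exp_le_exp.2 ((Finset.sum_le_card_nsmul _ _ 1 fun s _ => ?_).trans (by simp))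
    have h1 : c * ξ s ω ≤ 1 := by nlinarith [(abs_le.1 (hξ1 s ω)).2]
    have h2 : 0 ≤ c ^ 2 * (A s).indicator (1 : Ω → ℝ) ω :=
      mul_nonneg (sq_nonneg c) (Set.indicator_nonneg (by simp) ω)
    linarith
  have hZi : ∀ t, Integrable (fun ω => Real.exp (∑ s ∈ Finset.range t,
      (c * ξ s ω - c ^ 2 * (A s).indicator 1 ω))) P := fun t =>
    Integrable.of_bound ((hadp t).mono (ℱ.le t)).aestronglyMeasurable (Real.exp t)
      (ae_of_all _ fun ω => by rw [Real.norm_eq_abs, Real.abs_exp]; exact hZ t ω)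
  refine supermartingale_nat hadp hZi fun t => ?_
  set Z : Ω → ℝ := fun ω => Real.exp (∑ s ∈ Finset.range t,
      (c * ξ s ω - c ^ 2 * (A s).indicator 1 ω)) with hZdef
  set d : ℝ := c * Real.exp (-c ^ 2)
  have hξi : Integrable (ξ t) P := Integrable.of_bound
    ((hξ t).mono (ℱ.le _) le_rfl).aestronglyMeasurable 1 (ae_of_all _ (hξ1 t))
  have hdξi : Integrable (d • ξ t) P := hξi.smul d
  have hZξi : Integrable (Z * d • ξ t) P := by
    refine hdξi.bdd_mul (c := Real.exp t) (hZi t).aestronglyMeasurable (ae_of_all _ fun ω => ?_)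
    rw [Real.norm_eq_abs, Real.abs_exp]; exact hZ t ω
  have hle : ∀ ω, Real.exp (∑ s ∈ Finset.range (t + 1),
      (c * ξ s ω - c ^ 2 * (A s).indicator 1 ω)) ≤ (Z + Z * d • ξ t) ω := fun ω => by
    rw [Finset.sum_range_succ, Real.exp_add]
    have : Real.exp (c * ξ t ω - c ^ 2 * (A t).indicator 1 ω) ≤ 1 + d * ξ t ω := by
      by_cases hω : ω ∈ A t
      · simpa [hω, d] using exp_mul_sub_sq_le hc hc1 (hξ1 t ω)
      · have h0 : ξ t ω = 0 := by simpa [hω] using hbound t ω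
        simp [hω, h0]
    have h2 := mul_le_mul_of_nonneg_left this (Real.exp_pos (∑ s ∈ Finset.range t,
      (c * ξ s ω - c ^ 2 * (A s).indicator 1 ω))).le
    rw [mul_add, mul_one] at h2
    exact h2
  have h1 := condExp_mono (m := ℱ t) (hZi (t + 1)) ((hZi t).add hZξi) (ae_of_all P hle)
  have h2 := condExp_add (m := ℱ t) (hZi t) hZξi
  have h3 := condExp_mul_of_stronglyMeasurable_left (hadp t) hZξi hdξi
  have h4 := condExp_smul (m := ℱ t) (μ := P) d (ξ t)
  have h5 := condExp_of_stronglyMeasurable (ℱ.le t) (hadp t) (hZi t)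
  filter_upwards [h1, h2, h3, h4, hcond t] with ω g1 g2 g3 g4 g5
  rw [g2] at g1
  simp only [Pi.add_apply] at g1
  rw [g3, h5] at g1
  simp only [Pi.mul_apply, g4, Pi.smul_apply, g5, Pi.zero_apply, smul_zero, mul_zero,
    add_zero] at g1
  exact g1

/-- One half of `ae_isLittleO_sum`: an almost surely convergent exponential supermartingale is
bounded, and its logarithm is the martingale minus a small multiple of its clock. -/
lemma ae_eventually_sum_le {ℱ : Filtration ℕ mΩ} {ξ : ℕ → Ω → ℝ} {A : ℕ → Set Ω}
    (hξ : ∀ s, Measurable[ℱ (s + 1)] (ξ s)) (hA : ∀ s, MeasurableSet[ℱ (s + 1)] (A s))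
    (hbound : ∀ s ω, |ξ s ω| ≤ (A s).indicator 1 ω) (hcond : ∀ s, P[ξ s | ℱ s] =ᵐ[P] 0)
    {c : ℝ} (hc : 0 < c) (hc1 : c ≤ 1) :
    ∀ᵐ ω ∂P, Tendsto (fun t => ∑ s ∈ Finset.range t, (A s).indicator (1 : Ω → ℝ) ω) atTop atTop →
      ∀ᶠ t in atTop, ∑ s ∈ Finset.range t, ξ s ω ≤
        2 * c * ∑ s ∈ Finset.range t, (A s).indicator 1 ω := by
  have hZ := supermartingale_exp hξ hA hbound hcond hc.le hc1
  have hbdd := hZ.neg.exists_ae_tendsto_of_bdd (R := 1) fun t => by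
    rw [Pi.neg_apply, eLpNorm_neg, eLpNorm_one_eq_lintegral_enorm,
      ← ofReal_integral_norm_eq_lintegral_enorm (hZ.integrable t)]
    simp only [Real.norm_eq_abs, Real.abs_exp]
    have := hZ.setIntegral_le (Nat.zero_le t) MeasurableSet.univ
    simp only [Measure.restrict_univ, Finset.range_zero, Finset.sum_empty, Real.exp_zero,
      integral_const, probReal_univ, smul_eq_mul, mul_one] at this
    simpa using this
  filter_upwards [hbdd] with ω ⟨z, hz⟩ hT
  have hz' := hz.neg
  simp only [Pi.neg_apply, neg_neg] at hz'
  obtain ⟨B, hB⟩ := hz'.bddAbove_range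
  have hB0 : 0 < B := (Real.exp_pos _).trans_le (hB ⟨0, rfl⟩)
  filter_upwards [hT.eventually_ge_atTop (Real.log B / c ^ 2)] with t ht
  have h1 := (Real.le_log_iff_exp_le hB0).2 (hB ⟨t, rfl⟩)
  rw [Finset.sum_sub_distrib, ← Finset.mul_sum, ← Finset.mul_sum] at h1
  rw [div_le_iff₀ (by positivity)] at ht
  refine le_of_mul_le_mul_left ?_ hc
  linarith

/-- **Law of large numbers with a random clock.** A martingale whose increments `ξ s` are bounded
by `1` and vanish off `A s` is negligible compared to the number of the `A s` that occurred, if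
infinitely many of them occur. The sets `A s` need not be predictable. -/
lemma ae_isLittleO_sum {ℱ : Filtration ℕ mΩ} {ξ : ℕ → Ω → ℝ} {A : ℕ → Set Ω}
    (hξ : ∀ s, Measurable[ℱ (s + 1)] (ξ s)) (hA : ∀ s, MeasurableSet[ℱ (s + 1)] (A s))
    (hbound : ∀ s ω, |ξ s ω| ≤ (A s).indicator 1 ω) (hcond : ∀ s, P[ξ s | ℱ s] =ᵐ[P] 0) :
    ∀ᵐ ω ∂P, Tendsto (fun t => ∑ s ∈ Finset.range t, (A s).indicator (1 : Ω → ℝ) ω) atTop atTop →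
      (fun t => ∑ s ∈ Finset.range t, ξ s ω) =o[atTop]
        fun t => ∑ s ∈ Finset.range t, (A s).indicator (1 : Ω → ℝ) ω := by
  have hc : ∀ N : ℕ, (0 : ℝ) < 1 / (N + 1) := fun N => by positivity
  have hc1 : ∀ N : ℕ, (1 : ℝ) / (N + 1) ≤ 1 := fun N => by
    rw [div_le_one (by positivity)]; simp
  have h1 := ae_all_iff.2 fun N : ℕ => ae_eventually_sum_le hξ hA hbound hcond (hc N) (hc1 N)
  have h2 := ae_all_iff.2 fun N : ℕ => ae_eventually_sum_le (ξ := fun s => -ξ s)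
    (fun s => (hξ s).neg) hA (fun s ω => by simpa using hbound s ω)
    (fun s => (condExp_neg _ _).trans (by
      filter_upwards [hcond s] with ω hω
      simp [hω])) (hc N) (hc1 N)
  filter_upwards [h1, h2] with ω g1 g2 hT
  refine Asymptotics.isLittleO_iff.2 fun ε hε => ?_
  obtain ⟨N, hN⟩ := exists_nat_one_div_lt (show 0 < ε / 2 by positivity)
  filter_upwards [g1 N hT, g2 N hT] with t k1 k2
  have hnn : 0 ≤ ∑ s ∈ Finset.range t, (A s).indicator (1 : Ω → ℝ) ω :=
    Finset.sum_nonneg fun s _ => Set.indicator_nonneg (by simp) ω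
  have hle : 2 * (1 / ((N : ℝ) + 1)) * ∑ s ∈ Finset.range t, (A s).indicator (1 : Ω → ℝ) ω ≤
      ε * ∑ s ∈ Finset.range t, (A s).indicator (1 : Ω → ℝ) ω :=
    mul_le_mul_of_nonneg_right (by linarith) hnn
  simp only [Pi.neg_apply, Finset.sum_neg_distrib] at k2
  rw [Real.norm_eq_abs, Real.norm_of_nonneg hnn, abs_le]
  constructor <;> linarith

/-- Centring at the conditional expectation given a larger σ-algebra `m'`, followed by a bounded
`m'`-measurable weight, gives conditional mean zero. -/
lemma condExp_mul_sub_eq_zero {m m' : MeasurableSpace Ω} (hm : m ≤ m') (hm' : m' ≤ mΩ)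
    {w f h : Ω → ℝ} (hw : Measurable[m'] w) (hw1 : ∀ ω, |w ω| ≤ 1) (hf : Integrable f P)
    (hh : Measurable[m'] h) (hhi : Integrable h P) (hfh : P[f | m'] =ᵐ[P] h) :
    P[w * (f - h) | m] =ᵐ[P] 0 := by
  have hi : Integrable (w * (f - h)) P := (hf.sub hhi).bdd_mul (c := 1)
    (hw.mono hm' le_rfl).aestronglyMeasurable (ae_of_all _ hw1)
  have h1 : P[w * (f - h) | m'] =ᵐ[P] 0 := by
    have e1 := condExp_mul_of_stronglyMeasurable_left hw.stronglyMeasurable hi (hf.sub hhi)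
    have e2 := condExp_sub hf hhi m'
    have e3 := condExp_of_stronglyMeasurable hm' hh.stronglyMeasurable hhi
    filter_upwards [e1, e2, hfh] with ω g1 g2 g3
    rw [g1, Pi.mul_apply, g2, Pi.sub_apply, g3, e3]
    simp
  calc P[w * (f - h) | m] =ᵐ[P] P[P[w * (f - h) | m'] | m] :=
        (condExp_condExp_of_le hm hm').symm
    _ =ᵐ[P] P[(0 : Ω → ℝ) | m] := condExp_congr_ae h1
    _ =ᵐ[P] 0 := by rw [condExp_zero]

end Martingale

/-! ### The margin of the best arm -/

section Arms

variable {K n : ℕ}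

/-- The expected number of duels won in a round by arm `j` against the opponents `o`. -/
noncomputable def expectedWins (φ : Fin K → Fin K → ℝ) (j : Fin K) (o : Fin n → Fin K) : ℝ :=
  ∑ k, (φ j (o k) + 1 / 2)

/-- The probability that arm `j` wins a duel with an opponent chosen uniformly among `n`
opponents with joint distribution `D` (and `0` if there are no opponents). -/
noncomputable def winRate (φ : Fin K → Fin K → ℝ) (D : PMF (Fin n → Fin K)) (j : Fin K) : ℝ :=
  (∑ o, (D o).toReal * expectedWins φ j o) / n

lemma sum_toReal_pmf {α : Type*} [Fintype α] (D : PMF α) : ∑ a, (D a).toReal = 1 := by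
  rw [← ENNReal.toReal_sum fun a _ => D.apply_ne_top a, ← tsum_fintype (L := .unconditional _),
    D.tsum_coe, ENNReal.toReal_one]

lemma natCast_mul_winRate (hn : 0 < n) (φ : Fin K → Fin K → ℝ) (D : PMF (Fin n → Fin K))
    (j : Fin K) : n * winRate φ D j = ∑ o, (D o).toReal * expectedWins φ j o := by
  have : (n : ℝ) ≠ 0 := by exact_mod_cast hn.ne'
  rw [winRate]
  field_simp

lemma IsPreference.winRate_le_one (hn : 0 < n) {φ : Fin K → Fin K → ℝ} (hφ : IsPreference φ)
    (D : PMF (Fin n → Fin K)) (j : Fin K) : winRate φ D j ≤ 1 := by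
  have hn' : (0 : ℝ) < n := by exact_mod_cast hn
  rw [winRate, div_le_one hn']
  calc ∑ o, (D o).toReal * expectedWins φ j o ≤ ∑ o, (D o).toReal * n := by
        gcongr with o
        refine (Finset.sum_le_card_nsmul _ _ 1 fun k _ => ?_).trans (by simp)
        linarith [(hφ.mem_Icc j (o k)).2]
    _ = n := by rw [← Finset.sum_mul, sum_toReal_pmf, one_mul]

/-- The best arm beats every other arm `j` uniformly: against each opponent `k` its winning
probability is larger by a fixed margin. For `j < k` this is Approximate Linearity; for `k ≤ j` it
only uses that the arms are ordered. -/
lemma exists_gap [NeZero K] {φ : Fin K → Fin K → ℝ} (hφ : IsPreference φ)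
    (hAL : ApproximateLinearity φ) :
    ∃ δ : ℝ, 0 < δ ∧ δ ≤ 1 ∧ ∀ j ≠ 0, ∀ k, φ j k + δ ≤ φ 0 k := by
  obtain ⟨γ, hγ, hAL⟩ := hAL
  have hpos : ∀ j ≠ 0, ∀ k, 0 < φ 0 k - φ j k := fun j hj k => by
    have h0j : 0 < φ 0 j := (hφ.pos_iff_lt 0 j).2 (Fin.pos_iff_ne_zero.2 hj)
    rcases lt_trichotomy j k with h | rfl | h
    · have := hAL 0 j k h0j ((hφ.pos_iff_lt j k).2 h)
      nlinarith [mul_pos hγ h0j]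
    · linarith [hφ.skew j j]
    · have h1 := (hφ.pos_iff_lt k j).2 h
      have h2 := hφ.skew j k
      rcases eq_or_ne k 0 with rfl | hk
      · linarith [hφ.skew 0 0]
      · linarith [(hφ.pos_iff_lt 0 k).2 (Fin.pos_iff_ne_zero.2 hk)]
  obtain ⟨p, hp⟩ := Finite.exists_min fun p : Fin K × Fin K =>
    if p.1 = 0 then 1 else min 1 (φ 0 p.2 - φ p.1 p.2)
  refine ⟨if p.1 = 0 then 1 else min 1 (φ 0 p.2 - φ p.1 p.2), ?_, ?_, fun j hj k => ?_⟩
  · split_ifs with h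
    · exact one_pos
    · exact lt_min one_pos (hpos _ h _)
  · split_ifs with h
    · exact le_rfl
    · exact min_le_left _ _
  · have := hp (j, k)
    simp only [hj, if_false] at this
    linarith [this.trans (min_le_right _ _)]

lemma winRate_add_le [NeZero K] (hn : 0 < n) {φ : Fin K → Fin K → ℝ} {δ : ℝ} {j : Fin K}
    (hδ : ∀ k, φ j k + δ ≤ φ 0 k) (D : PMF (Fin n → Fin K)) :
    winRate φ D j + δ ≤ winRate φ D 0 := by
  have hn' : (0 : ℝ) < n := by exact_mod_cast hn
  have h : ∑ o, (D o).toReal * (expectedWins φ j o + n * δ) ≤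
      ∑ o, (D o).toReal * expectedWins φ 0 o := by
    gcongr with o
    have : (n : ℝ) * δ = ∑ _k : Fin n, δ := by simp
    rw [this, expectedWins, expectedWins, ← Finset.sum_add_distrib]
    exact Finset.sum_le_sum fun k _ => by linarith [hδ (o k)]
  simp_rw [mul_add] at h
  rw [Finset.sum_add_distrib, ← Finset.sum_mul, sum_toReal_pmf, ← natCast_mul_winRate hn,
    ← natCast_mul_winRate hn] at h
  refine le_of_mul_le_mul_left ?_ hn'
  linarith

end Arms

/-! ### Counts of plays and posterior distributions -/

section Counts

variable {Ω : Type*} {K n : ℕ} {I : ℕ → Ω → Fin K} {X : ℕ → Ω → Fin n → Bool}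

/-- The number of rounds before `t` in which arm `j` was played, as a real number. -/
noncomputable def plays (I : ℕ → Ω → Fin K) (j : Fin K) (t : ℕ) (ω : Ω) : ℝ :=
  ∑ s ∈ Finset.range t, {ω | I s ω = j}.indicator (1 : Ω → ℝ) ω

/-- The marginal of the posterior in round `t` at the arm `j`. -/
noncomputable def armPosterior (I : ℕ → Ω → Fin K) (X : ℕ → Ω → Fin n → Bool) (t : ℕ) (ω : Ω)
    (j : Fin K) : Measure ℝ :=
  betaMeasure ((wins I X j t ω : ℝ) + 1) ((losses I X j t ω : ℝ) + 1)

instance (t : ℕ) (ω : Ω) (j : Fin K) : IsProbabilityMeasure (armPosterior I X t ω j) :=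
  isProbabilityMeasureBeta (by positivity) (by positivity)

instance (t : ℕ) (ω : Ω) : IsProbabilityMeasure (posterior I X t ω) :=
  inferInstanceAs (IsProbabilityMeasure (Measure.pi (armPosterior I X t ω)))

lemma wins_eq_sum (j : Fin K) (t : ℕ) (ω : Ω) :
    (wins I X j t ω : ℝ) = ∑ s ∈ Finset.range t, {ω | I s ω = j}.indicator (1 : Ω → ℝ) ω *
      ∑ k, {ω | X s ω k = true}.indicator (1 : Ω → ℝ) ω := by
  simp only [wins, Nat.cast_sum, Finset.mul_sum]
  refine Finset.sum_congr rfl fun s _ => Finset.sum_congr rfl fun k _ => ?_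
  by_cases h1 : I s ω = j <;> by_cases h2 : X s ω k = true <;> simp [h1, h2]

lemma wins_add_losses (j : Fin K) (t : ℕ) (ω : Ω) :
    (wins I X j t ω : ℝ) + losses I X j t ω = n * plays I j t ω := by
  simp only [wins, losses, plays, Nat.cast_sum, Finset.mul_sum, ← Finset.sum_add_distrib]
  refine Finset.sum_congr rfl fun s _ => ?_
  have : ∀ k : Fin n, (((if I s ω = j ∧ X s ω k = true then 1 else 0 : ℕ) : ℝ) +
      ((if I s ω = j ∧ X s ω k = false then 1 else 0 : ℕ) : ℝ)) =
      {ω | I s ω = j}.indicator (1 : Ω → ℝ) ω := fun k => by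
    by_cases h1 : I s ω = j <;> cases h2 : X s ω k <;> simp [h1]
  rw [Finset.sum_congr rfl fun k _ => this k]
  simp

/-- An arm that is not played infinitely often is eventually not played at all. -/
lemma eventually_ne_of_not_tendsto_plays {j : Fin K} {ω : Ω}
    (h : ¬ Tendsto (fun t => plays I j t ω) atTop atTop) : ∀ᶠ t in atTop, I t ω ≠ j := by
  have hs := (summable_iff_not_tendsto_nat_atTop_of_nonneg
    (f := fun s => {ω | I s ω = j}.indicator (1 : Ω → ℝ) ω)
    fun s => Set.indicator_nonneg (by simp) ω).2 h
  filter_upwards [hs.tendsto_atTop_zero.eventually_lt_const one_pos] with t ht hI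
  simp [hI] at ht

/-- The posterior of an arm that is not played infinitely often is eventually frozen. -/
lemma exists_eventually_armPosterior_eq {j : Fin K} {ω : Ω}
    (h : ¬ Tendsto (fun t => plays I j t ω) atTop atTop) :
    ∃ N, ∀ᶠ t in atTop, armPosterior I X t ω j = armPosterior I X N ω j := by
  obtain ⟨N, hN⟩ := eventually_atTop.1 (eventually_ne_of_not_tendsto_plays h)
  refine ⟨N, eventually_atTop.2 ⟨N, fun t ht => ?_⟩⟩
  have : wins I X j t ω = wins I X j N ω ∧ losses I X j t ω = losses I X j N ω := by
    induction t, ht using Nat.le_induction with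
    | base => exact ⟨rfl, rfl⟩
    | succ t ht ih =>
      rw [← ih.1, ← ih.2]
      simp [wins, losses, Finset.sum_range_succ, hN t ht]
  rw [armPosterior, armPosterior, this.1, this.2]

/-- The posterior of an arm that is played infinitely often concentrates at the limit `p` of
its empirical winning rate. -/
lemma tendsto_armPosterior_real (hn : 0 < n) {j : Fin K} {ω : Ω} {p : ℝ}
    (h : Tendsto (fun t => plays I j t ω) atTop atTop)
    (hp : (fun t => (wins I X j t ω : ℝ) - n * p * plays I j t ω) =o[atTop]
      fun t => plays I j t ω) {ε : ℝ} (hε : 0 < ε) :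
    Tendsto (fun t => (armPosterior I X t ω j).real {x | ε ≤ |x - p|}) atTop (𝓝 0) := by
  have hn' : (0 : ℝ) < n := by exact_mod_cast hn
  have hsum : ∀ t, ((wins I X j t ω : ℝ) + 1) + ((losses I X j t ω : ℝ) + 1) =
      n * plays I j t ω + 2 := fun t => by rw [← wins_add_losses (X := X)]; ring
  refine tendsto_betaMeasure_real (fun t => by positivity) (fun t => by positivity) ?_ ?_ hε
  · simp_rw [hsum]
    exact tendsto_atTop_add_const_right _ _ (h.const_mul_atTop hn')
  · simp_rw [hsum]
    have hinv : Tendsto (fun t => (plays I j t ω)⁻¹) atTop (𝓝 0) := tendsto_inv_atTop_zero.comp h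
    have h1 := ((hp.tendsto_div_nhds_zero.add_const (n * p)).add hinv).div
      ((hinv.const_mul 2).const_add (n : ℝ)) (by simpa using hn'.ne')
    rw [show (0 + n * p + 0) / (n + 2 * 0) = p by field_simp; ring] at h1
    refine h1.congr' ?_
    filter_upwards [h.eventually_gt_atTop 0] with t ht
    simp only [Pi.div_apply]
    have h2 : 0 < n * plays I j t ω + 2 := by positivity
    field_simp
    ring

lemma armPosterior_real_Ioo_pos (t : ℕ) (ω : Ω) (j : Fin K) {u v : ℝ} (hu : 0 ≤ u)
    (huv : u < v) (hv : v ≤ 1) : 0 < (armPosterior I X t ω j).real (Set.Ioo u v) :=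
  betaMeasure_real_Ioo_pos (by positivity) (by positivity) hu huv hv

lemma posterior_real_preimage_eval (t : ℕ) (ω : Ω) (j : Fin K) {s : Set ℝ}
    (hs : MeasurableSet s) :
    (posterior I X t ω).real (Function.eval j ⁻¹' s) = (armPosterior I X t ω j).real s :=
  (measurePreserving_eval (armPosterior I X t ω) j).measureReal_preimage hs.nullMeasurableSet

/-- Samples of two arms whose order disagrees with that of `p` and `q` lie far from these. -/
lemma posterior_real_le [NeZero K] (t : ℕ) (ω : Ω) (j : Fin K) {p q ε : ℝ} (h : p + 2 * ε ≤ q) :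
    (posterior I X t ω).real {x | x 0 ≤ x j} ≤
      (armPosterior I X t ω j).real {x | ε ≤ |x - p|} +
        (armPosterior I X t ω 0).real {x | ε ≤ |x - q|} := by
  have hm : ∀ r : ℝ, MeasurableSet {x : ℝ | ε ≤ |x - r|} := fun r =>
    measurableSet_le measurable_const (by fun_prop)
  rw [← posterior_real_preimage_eval t ω j (hm p), ← posterior_real_preimage_eval t ω 0 (hm q)]
  refine (measureReal_mono fun x hx => ?_).trans (measureReal_union_le _ _)
  by_contra hcon
  simp only [Set.mem_union, Set.mem_preimage, Set.mem_ofPred_eq, not_or, not_le,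
    Function.eval] at hcon hx
  linarith [(abs_lt.1 hcon.1).2, (abs_lt.1 hcon.2).1]

/-- The samples that separate the best arm from all others at the level `c`. -/
def separated [NeZero K] (c : ℝ) : Set (Fin K → ℝ) :=
  Set.univ.pi fun j => if j = 0 then Set.Ioi c else Set.Iio c

lemma measurableSet_separated [NeZero K] (c : ℝ) : MeasurableSet (separated c : Set (Fin K → ℝ)) :=
  MeasurableSet.univ_pi fun j => by split_ifs <;> measurability

lemma posterior_real_separated [NeZero K] (t : ℕ) (ω : Ω) (c : ℝ) :
    (posterior I X t ω).real (separated c) =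
      ∏ j, (armPosterior I X t ω j).real (if j = 0 then Set.Ioi c else Set.Iio c) := by
  rw [measureReal_def, separated]
  change (Measure.pi (armPosterior I X t ω) _).toReal = _
  rw [Measure.pi_pi, ENNReal.toReal_prod]
  rfl

/-- If the best arm were played finitely often, its sample would keep exceeding those of all other
arms with probability bounded below: a frozen posterior charges every interval, and the arms that
are played infinitely often concentrate at values away from `1`. -/
lemma exists_eventually_le_posterior_separated [NeZero K] (hn : 0 < n) {ω : Ω} {p : Fin K → ℝ}
    {ε : ℝ} (hε : 0 < ε) (hε1 : ε < 1) (hp0 : ∀ j ≠ 0, p j + 2 * ε ≤ 1)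
    (hp : ∀ j, Tendsto (fun t => plays I j t ω) atTop atTop →
      (fun t => (wins I X j t ω : ℝ) - n * p j * plays I j t ω) =o[atTop]
        fun t => plays I j t ω)
    (h0 : ¬ Tendsto (fun t => plays I 0 t ω) atTop atTop) :
    ∃ e : ℝ, 0 < e ∧ ∀ᶠ t in atTop, e ≤ (posterior I X t ω).real (separated (1 - ε)) := by
  have hj : ∀ j, ∃ e : ℝ, 0 < e ∧ ∀ᶠ t in atTop, e ≤ (armPosterior I X t ω j).real
      (if j = 0 then Set.Ioi (1 - ε) else Set.Iio (1 - ε)) := fun j => by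
    by_cases h : Tendsto (fun t => plays I j t ω) atTop atTop
    · have hj0 : j ≠ 0 := fun hj => h0 (hj ▸ h)
      refine ⟨1 / 2, by norm_num, ?_⟩
      filter_upwards [(tendsto_armPosterior_real hn h (hp j h) hε).eventually_lt_const
        (show (0 : ℝ) < 1 / 2 by norm_num)] with t ht
      have hsub : (Set.Iio (1 - ε))ᶜ ⊆ {x | ε ≤ |x - p j|} := fun x hx => by
        simp only [Set.mem_compl_iff, Set.mem_Iio, not_lt] at hx
        have : ε ≤ x - p j := by linarith [hp0 j hj0]
        exact this.trans (le_abs_self _)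
      have h1 := (measureReal_mono (μ := armPosterior I X t ω j) hsub).trans_lt ht
      rw [probReal_compl_eq_one_sub measurableSet_Iio] at h1
      rw [if_neg hj0]
      linarith
    · obtain ⟨N, hN⟩ := exists_eventually_armPosterior_eq (X := X) h
      refine ⟨_, ?_, hN.mono fun t ht => by rw [ht]⟩
      split_ifs
      · exact (armPosterior_real_Ioo_pos N ω j (by linarith) (by linarith) le_rfl).trans_le
          (measureReal_mono (fun x hx => hx.1 : Set.Ioo (1 - ε) 1 ⊆ _))
      · exact (armPosterior_real_Ioo_pos N ω j le_rfl (by linarith) (by linarith)).trans_le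
          (measureReal_mono (fun x hx => hx.2 : Set.Ioo 0 (1 - ε) ⊆ _))
  choose e he hle using hj
  refine ⟨∏ j, e j, Finset.prod_pos fun j _ => he j, ?_⟩
  filter_upwards [eventually_all.2 hle] with t ht
  rw [posterior_real_separated]
  exact Finset.prod_le_prod (fun j _ => (he j).le) fun j _ => ht j

end Counts

/-! ### Centred outcomes and opponents -/

section Noise

variable {Ω : Type*} {K n : ℕ} {φ : Fin K → Fin K → ℝ} {I : ℕ → Ω → Fin K}
  {O : ℕ → Ω → Fin n → Fin K} {X : ℕ → Ω → Fin n → Bool} {D : ℕ → Ω → PMF (Fin n → Fin K)}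

/-- The deviation of the outcome of a duel from its conditional expectation, counted in the rounds
in which arm `j` is played. -/
noncomputable def outcomeNoise (φ : Fin K → Fin K → ℝ) (I : ℕ → Ω → Fin K)
    (O : ℕ → Ω → Fin n → Fin K) (X : ℕ → Ω → Fin n → Bool) (j : Fin K) (k : Fin n) (s : ℕ) :
    Ω → ℝ :=
  {ω | I s ω = j}.indicator 1 *
    ({ω | X s ω k = true}.indicator (fun _ => 1) - fun ω => φ (I s ω) (O s ω k) + 1 / 2)

/-- The deviation of the indicator of the opponents `o` from its conditional expectation, counted
in the rounds in which arm `j` is played. -/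
noncomputable def opponentNoise (I : ℕ → Ω → Fin K) (O : ℕ → Ω → Fin n → Fin K)
    (D : ℕ → Ω → PMF (Fin n → Fin K)) (j : Fin K) (o : Fin n → Fin K) (s : ℕ) : Ω → ℝ :=
  {ω | I s ω = j}.indicator 1 *
    ((O s ⁻¹' {o}).indicator (fun _ => 1) - fun ω => (D s ω o).toReal)

/-- A difference of two numbers of the unit interval, restricted to a set, is bounded by the
indicator of the set. -/
lemma abs_indicator_mul_sub_le {A B : Set Ω} {x : ℝ} {ω : Ω} (h0 : 0 ≤ x) (h1 : x ≤ 1) :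
    |A.indicator 1 ω * (B.indicator (fun _ => 1) ω - x)| ≤ A.indicator 1 ω := by
  by_cases hA : ω ∈ A <;> by_cases hB : ω ∈ B <;>
    simp [hA, hB, abs_le] <;> constructor <;> linarith

lemma measurable_indicator_mul_sub {m : MeasurableSpace Ω} {A B : Set Ω} {h : Ω → ℝ}
    (hA : MeasurableSet[m] A) (hB : MeasurableSet[m] B) (hh : Measurable[m] h) :
    Measurable[m] (A.indicator 1 * (B.indicator (fun _ => 1) - h)) :=
  ((stronglyMeasurable_one.indicator hA).measurable).mul
    (((stronglyMeasurable_const.indicator hB).measurable).sub hh)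

lemma condExp_indicator_mul_sub_eq_zero {m m' mΩ : MeasurableSpace Ω}
    {P : Measure Ω} [IsProbabilityMeasure P] (hm : m ≤ m') (hm' : m' ≤ mΩ)
    {A B : Set Ω} {h : Ω → ℝ} (hA : MeasurableSet[m'] A) (hB : MeasurableSet[mΩ] B)
    (hh : Measurable[m'] h) (h0 : ∀ ω, 0 ≤ h ω) (h1 : ∀ ω, h ω ≤ 1)
    (hBh : P⟦B | m'⟧ =ᵐ[P] h) :
    P[A.indicator 1 * (B.indicator (fun _ => 1) - h) | m] =ᵐ[P] 0 := by
  refine condExp_mul_sub_eq_zero hm hm' (stronglyMeasurable_one.indicator hA).measurable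
    (fun ω => ?_) ((integrable_const 1).indicator hB) hh ?_ hBh
  · by_cases hω : ω ∈ A <;> simp [hω]
  · refine Integrable.of_bound (hh.mono hm' le_rfl).aestronglyMeasurable 1 (ae_of_all _ fun ω => ?_)
    rw [Real.norm_of_nonneg (h0 ω)]
    exact h1 ω

/-- In each round, the centred number of wins of arm `j` splits into the noise of the outcomes, the
noise of the choice of opponents, and the deviation of the opponents' distribution from `q`. -/
lemma wins_decomposition (hn : 0 < n) (q : PMF (Fin n → Fin K)) (j : Fin K) (s : ℕ) (ω : Ω) :
    {ω | I s ω = j}.indicator (1 : Ω → ℝ) ω * (∑ k, {ω | X s ω k = true}.indicator 1 ω)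
        - n * winRate φ q j * {ω | I s ω = j}.indicator (1 : Ω → ℝ) ω =
      (∑ k, outcomeNoise φ I O X j k s ω + ∑ o, expectedWins φ j o * opponentNoise I O D j o s ω)
        + ∑ o, expectedWins φ j o * ({ω | I s ω = j}.indicator (1 : Ω → ℝ) ω *
          ((D s ω o).toReal - (q o).toReal)) := by
  by_cases hI : I s ω = j
  · have h1 : ∑ o, expectedWins φ j o * (O s ⁻¹' {o}).indicator (fun _ => (1 : ℝ)) ω =
        expectedWins φ j (O s ω) := by
      rw [Finset.sum_eq_single (O s ω)]
      · simp
      · intro o _ ho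
        simp [ho.symm]
      · simp
    rw [natCast_mul_winRate hn]
    simp only [outcomeNoise, opponentNoise, Pi.mul_apply, Pi.sub_apply, Set.indicator,
      Set.mem_ofPred_eq, hI, if_true, Pi.one_apply, one_mul, mul_sub, Finset.sum_sub_distrib]
        at h1 ⊢
    rw [h1, expectedWins]
    simp only [mul_comm (expectedWins φ j _)]
    ring
  · simp [outcomeNoise, opponentNoise, hI]

end Noise

/-! ### Long-run behaviour of Thompson sampling -/

section Play

variable {Ω : Type*} {K n : ℕ} [mΩ : MeasurableSpace Ω] {P : Measure Ω}
  {φ : Fin K → Fin K → ℝ} {ℱ : Filtration ℕ mΩ} {θ : ℕ → Ω → Fin K → ℝ} {I : ℕ → Ω → Fin K}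
  {O : ℕ → Ω → Fin n → Fin K} {X : ℕ → Ω → Fin n → Bool} {D : ℕ → Ω → PMF (Fin n → Fin K)}

lemma ae_condProb_arm_nonneg (t : ℕ) (j : Fin K) :
    ∀ᵐ ω ∂P, 0 ≤ (P⟦{ω | I t ω = j} | ℱ t⟧) ω :=
  condExp_nonneg (ae_of_all _ fun ω => Set.indicator_nonneg (by simp) ω)

namespace IsThompsonPlay

lemma measurableSet_arm (hplay : IsThompsonPlay P φ ℱ θ I O X D) (s : ℕ) (j : Fin K) :
    MeasurableSet[ℱ (s + 1)] {ω | I s ω = j} :=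
  hplay.measurable_arm s (measurableSet_singleton j)

lemma measurableSet_outcome (hplay : IsThompsonPlay P φ ℱ θ I O X D) (s : ℕ) (k : Fin n) :
    MeasurableSet[ℱ (s + 1)] {ω | X s ω k = true} :=
  ((measurable_pi_apply k).comp (hplay.measurable_outcome s)) (measurableSet_singleton true)

lemma measurableSet_opponents (hplay : IsThompsonPlay P φ ℱ θ I O X D) (s : ℕ)
    (o : Fin n → Fin K) : MeasurableSet[ℱ (s + 1)] (O s ⁻¹' {o}) :=
  hplay.measurable_opponents s (measurableSet_singleton o)

lemma measurableSet_arm' (hplay : IsThompsonPlay P φ ℱ θ I O X D) (s : ℕ) (j : Fin K) :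
    MeasurableSet {ω | I s ω = j} :=
  ℱ.le _ _ (hplay.measurableSet_arm s j)

variable [IsProbabilityMeasure P]

lemma ae_isLittleO_outcomeNoise (hφ : IsPreference φ) (hplay : IsThompsonPlay P φ ℱ θ I O X D)
    (j : Fin K) (k : Fin n) :
    ∀ᵐ ω ∂P, Tendsto (fun t => plays I j t ω) atTop atTop →
      (fun t => ∑ s ∈ Finset.range t, outcomeNoise φ I O X j k s ω) =o[atTop]
        fun t => plays I j t ω := by
  have h0 : ∀ s ω, 0 ≤ φ (I s ω) (O s ω k) + 1 / 2 := fun s ω => by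
    linarith [(hφ.mem_Icc (I s ω) (O s ω k)).1]
  have h1 : ∀ s ω, φ (I s ω) (O s ω k) + 1 / 2 ≤ 1 := fun s ω => by
    linarith [(hφ.mem_Icc (I s ω) (O s ω k)).2]
  have hg : Measurable fun p : Fin K × (Fin n → Fin K) => φ p.1 (p.2 k) + 1 / 2 :=
    Measurable.of_discrete
  refine ae_isLittleO_sum (fun s => ?_) (fun s => hplay.measurableSet_arm s j)
    (fun s ω => abs_indicator_mul_sub_le (h0 s ω) (h1 s ω)) fun s => ?_
  · exact measurable_indicator_mul_sub (hplay.measurableSet_arm s j)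
      (hplay.measurableSet_outcome s k)
      (hg.comp ((hplay.measurable_arm s).prodMk (hplay.measurable_opponents s)))
  · have hpair : Measurable fun ω => (I s ω, O s ω) :=
      ((hplay.measurable_arm s).mono (ℱ.le _) le_rfl).prodMk
        ((hplay.measurable_opponents s).mono (ℱ.le _) le_rfl)
    have hc : Measurable[(ℱ s : MeasurableSpace Ω) ⊔
        MeasurableSpace.comap (fun ω => (I s ω, O s ω)) inferInstance] fun ω => (I s ω, O s ω) :=
      (comap_measurable _).mono le_sup_right le_rfl
    refine condExp_indicator_mul_sub_eq_zero le_sup_left (sup_le (ℱ.le s) hpair.comap_le) ?_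
      (ℱ.le _ _ (hplay.measurableSet_outcome s k)) ?_ (h0 s) (h1 s) (hplay.outcome_law s k)
    · exact (measurable_fst.comp hc) (measurableSet_singleton j)
    · exact hg.comp hc

lemma ae_isLittleO_opponentNoise (hplay : IsThompsonPlay P φ ℱ θ I O X D) (j : Fin K)
    (o : Fin n → Fin K) :
    ∀ᵐ ω ∂P, Tendsto (fun t => plays I j t ω) atTop atTop →
      (fun t => ∑ s ∈ Finset.range t, opponentNoise I O D j o s ω) =o[atTop]
        fun t => plays I j t ω := by
  have h1 : ∀ s ω, (D s ω o).toReal ≤ 1 := fun s ω =>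
    ENNReal.toReal_mono ENNReal.one_ne_top ((D s ω).coe_le_one o)
  have hD : ∀ s, Measurable[ℱ s] fun ω => (D s ω o).toReal := fun s =>
    ENNReal.measurable_toReal.comp (hplay.measurable_dist s o)
  refine ae_isLittleO_sum (fun s => ?_) (fun s => hplay.measurableSet_arm s j)
    (fun s ω => abs_indicator_mul_sub_le ENNReal.toReal_nonneg (h1 s ω)) fun s => ?_
  · exact measurable_indicator_mul_sub (hplay.measurableSet_arm s j)
      (hplay.measurableSet_opponents s o) ((hD s).mono (ℱ.mono s.le_succ) le_rfl)
  · have hI : Measurable (I s) := (hplay.measurable_arm s).mono (ℱ.le _) le_rfl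
    have hc : Measurable[(ℱ s : MeasurableSpace Ω) ⊔ MeasurableSpace.comap (I s) inferInstance]
        (I s) := (comap_measurable _).mono le_sup_right le_rfl
    exact condExp_indicator_mul_sub_eq_zero le_sup_left (sup_le (ℱ.le s) hI.comap_le)
      (hc (measurableSet_singleton j)) (ℱ.le _ _ (hplay.measurableSet_opponents s o))
      ((hD s).mono le_sup_left le_rfl) (fun ω => ENNReal.toReal_nonneg) (h1 s)
      (hplay.opponents_law s o)

/-- The empirical winning rate of an arm that is played infinitely often tends to its winning rate
against the limit of the opponents' distributions. -/
lemma ae_isLittleO_wins (hn : 0 < n) (hφ : IsPreference φ)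
    (hplay : IsThompsonPlay P φ ℱ θ I O X D) {Dlim : Ω → PMF (Fin n → Fin K)}
    (hconv : ∀ᵐ ω ∂P, ∀ o, Tendsto (fun t => D t ω o) atTop (𝓝 (Dlim ω o))) :
    ∀ᵐ ω ∂P, ∀ j, Tendsto (fun t => plays I j t ω) atTop atTop →
      (fun t => (wins I X j t ω : ℝ) - n * winRate φ (Dlim ω) j * plays I j t ω) =o[atTop]
        fun t => plays I j t ω := by
  have h1 := ae_all_iff.2 fun j => ae_all_iff.2 fun k => ae_isLittleO_outcomeNoise hφ hplay j k
  have h2 := ae_all_iff.2 fun j => ae_all_iff.2 fun o => ae_isLittleO_opponentNoise hplay j o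
  filter_upwards [h1, h2, hconv] with ω g1 g2 g3 j hj
  have h3 : ∀ o, (fun t => ∑ s ∈ Finset.range t, {ω | I s ω = j}.indicator (1 : Ω → ℝ) ω *
      ((D s ω o).toReal - (Dlim ω o).toReal)) =o[atTop] fun t => plays I j t ω := fun o => by
    refine Asymptotics.IsLittleO.sum_range ?_ (fun s => Set.indicator_nonneg (by simp) ω) hj
    have ht := ((ENNReal.tendsto_toReal ((Dlim ω).apply_ne_top o)).comp (g3 o)).sub_const
      (Dlim ω o).toReal
    rw [sub_self] at ht
    have := (Asymptotics.isBigO_refl (fun s => {ω | I s ω = j}.indicator (1 : Ω → ℝ) ω)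
      atTop).mul_isLittleO ((Asymptotics.isLittleO_one_iff ℝ).2 ht)
    simpa using this
  have h4 := ((Asymptotics.IsLittleO.sum (s := Finset.univ) fun k _ => g1 j k hj).add
    (Asymptotics.IsLittleO.sum (s := Finset.univ) fun o _ =>
      (g2 j o hj).const_mul_left (expectedWins φ j o))).add
    (Asymptotics.IsLittleO.sum (s := Finset.univ) fun o _ =>
      (h3 o).const_mul_left (expectedWins φ j o))
  refine h4.congr_left fun t => ?_
  rw [wins_eq_sum, plays, Finset.mul_sum, ← Finset.sum_sub_distrib,
    Finset.sum_congr rfl fun s _ => wins_decomposition (φ := φ) (O := O) (D := D) hn (Dlim ω) j s ω]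
  simp only [Finset.sum_add_distrib, Finset.sum_apply, Finset.mul_sum]
  congr 1
  · congr 1
    · exact Finset.sum_comm
    · exact Finset.sum_comm
  · exact Finset.sum_comm

/-- Conditional Borel–Cantelli: an arm is played infinitely often if and only if its conditional
probabilities of being played have infinite sum. -/
lemma ae_tendsto_plays_iff (hplay : IsThompsonPlay P φ ℱ θ I O X D) (j : Fin K) :
    ∀ᵐ ω ∂P, Tendsto (fun t => plays I j t ω) atTop atTop ↔
      Tendsto (fun t => ∑ s ∈ Finset.range t, (P⟦{ω | I s ω = j} | ℱ s⟧) ω) atTop atTop := by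
  -- The set with index `s + 1` is known at time `s + 1`; the set with index `0` plays no role.
  let A : ℕ → Set Ω := fun s => {ω | s ≠ 0 ∧ I (s - 1) ω = j}
  have hA1 : ∀ s, A (s + 1) = {ω | I s ω = j} := fun s => by simp [A]
  have hA : ∀ s, MeasurableSet[ℱ s] (A s) := fun s => by
    cases s with
    | zero => simp [A]
    | succ r => exact hA1 r ▸ hplay.measurableSet_arm r j
  have h := tendsto_sum_indicator_atTop_iff' (μ := P) hA
  simp only [hA1] at h
  exact h

/-- If arm `j` is only played when the samples lie in `A`, its conditional probability of being
played is at most the posterior probability of `A`. -/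
lemma ae_condProb_arm_le (hplay : IsThompsonPlay P φ ℱ θ I O X D) {A : Set (Fin K → ℝ)}
    (hA : MeasurableSet A) (t : ℕ) {j : Fin K} (h : ∀ ω, I t ω = j → θ t ω ∈ A) :
    ∀ᵐ ω ∂P, (P⟦{ω | I t ω = j} | ℱ t⟧) ω ≤ (posterior I X t ω).real A := by
  have := condExp_mono (m := ℱ t) (μ := P)
    ((integrable_const (1 : ℝ)).indicator (hplay.measurableSet_arm' t j))
    ((integrable_const (1 : ℝ)).indicator (hplay.measurable_sample t hA))
    (ae_of_all _ (Set.indicator_le_indicator_of_subset h (fun _ => zero_le_one)))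
  filter_upwards [this, hplay.sample_law t A hA] with ω h1 h2
  exact h1.trans_eq h2

/-- If arm `j` is always played when the samples lie in `A`, its conditional probability of being
played is at least the posterior probability of `A`. -/
lemma ae_le_condProb_arm (hplay : IsThompsonPlay P φ ℱ θ I O X D) {A : Set (Fin K → ℝ)}
    (hA : MeasurableSet A) (t : ℕ) {j : Fin K} (h : ∀ ω, θ t ω ∈ A → I t ω = j) :
    ∀ᵐ ω ∂P, (posterior I X t ω).real A ≤ (P⟦{ω | I t ω = j} | ℱ t⟧) ω := by
  have := condExp_mono (m := ℱ t) (μ := P)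
    ((integrable_const (1 : ℝ)).indicator (hplay.measurable_sample t hA))
    ((integrable_const (1 : ℝ)).indicator (hplay.measurableSet_arm' t j))
    (ae_of_all _ (Set.indicator_le_indicator_of_subset h (fun _ => zero_le_one)))
  filter_upwards [this, hplay.sample_law t A hA] with ω h1 h2
  exact h2.symm.trans_le h1

/-- The conditional probability of playing a suboptimal arm tends to `0`. If the arm is played
finitely often, these probabilities are summable; otherwise its posterior and that of the best arm
concentrate at different values. -/
lemma ae_tendsto_condProb_arm [NeZero K] (hn : 0 < n) (hφ : IsPreference φ)
    (hAL : ApproximateLinearity φ) (hplay : IsThompsonPlay P φ ℱ θ I O X D)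
    {Dlim : Ω → PMF (Fin n → Fin K)}
    (hconv : ∀ᵐ ω ∂P, ∀ o, Tendsto (fun t => D t ω o) atTop (𝓝 (Dlim ω o)))
    {j : Fin K} (hj : j ≠ 0) :
    ∀ᵐ ω ∂P, Tendsto (fun t => (P⟦{ω | I t ω = j} | ℱ t⟧) ω) atTop (𝓝 0) := by
  obtain ⟨δ, hδ, hδ1, hgap⟩ := exists_gap hφ hAL
  -- All winning rates of suboptimal arms are at most `1 - δ`, so `1 - δ / 2` is a level that works
  -- whatever the random limit distribution is.
  have hle := ae_all_iff.2 fun t => hplay.ae_condProb_arm_le (A := {x | x 0 ≤ x j})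
    (measurableSet_le (measurable_pi_apply 0) (measurable_pi_apply j)) t
    (j := j) fun ω hω =>
      (hplay.arm_argmax t ω 0).trans_eq (by rw [hω])
  have hge := ae_all_iff.2 fun t => hplay.ae_le_condProb_arm
    (measurableSet_separated (1 - δ / 2)) t (j := 0) fun ω hω => by
      by_contra hI
      have h0 := hω 0 trivial
      have h1 := hω (I t ω) trivial
      simp only [if_true, hI, if_false, Set.mem_Ioi, Set.mem_Iio] at h0 h1
      linarith [hplay.arm_argmax t ω 0]
  have hnn := ae_all_iff.2 fun i => ae_all_iff.2 fun t =>
    ae_condProb_arm_nonneg (P := P) (I := I) (ℱ := ℱ) t i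
  filter_upwards [hle, hge, hnn, hplay.ae_isLittleO_wins hn hφ hconv,
    hplay.ae_tendsto_plays_iff 0, hplay.ae_tendsto_plays_iff j] with ω hle hge hnn hwins h0 hj'
  have hrate : ∀ i ≠ 0, winRate φ (Dlim ω) i + 2 * (δ / 2) ≤ winRate φ (Dlim ω) 0 := fun i hi => by
    linarith [winRate_add_le hn (hgap i hi) (Dlim ω)]
  have hplays0 : Tendsto (fun t => plays I 0 t ω) atTop atTop := by
    by_contra hcon
    obtain ⟨e, he, hev⟩ := exists_eventually_le_posterior_separated hn (half_pos hδ) (by linarith)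
      (fun i hi => (hrate i hi).trans (hφ.winRate_le_one hn _ _)) hwins hcon
    have hq := ((summable_iff_not_tendsto_nat_atTop_of_nonneg (hnn 0)).2
      (h0.not.1 hcon)).tendsto_atTop_zero
    obtain ⟨t, h1, h2⟩ := ((hq.eventually_lt_const he).and hev).exists
    linarith [hge t]
  by_cases hplaysj : Tendsto (fun t => plays I j t ω) atTop atTop
  · have hlim := (tendsto_armPosterior_real hn hplaysj (hwins j hplaysj) (half_pos hδ)).add
      (tendsto_armPosterior_real hn hplays0 (hwins 0 hplays0) (half_pos hδ))
    rw [add_zero] at hlim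
    exact squeeze_zero (hnn j) (fun t => (hle t).trans (posterior_real_le t ω j (hrate j hj))) hlim
  · rw [hj'] at hplaysj
    exact ((summable_iff_not_tendsto_nat_atTop_of_nonneg (hnn j)).2 hplaysj).tendsto_atTop_zero

lemma tendsto_measureReal_arm [NeZero K] (hn : 0 < n) (hφ : IsPreference φ)
    (hAL : ApproximateLinearity φ) (hplay : IsThompsonPlay P φ ℱ θ I O X D)
    {Dlim : Ω → PMF (Fin n → Fin K)}
    (hconv : ∀ᵐ ω ∂P, ∀ o, Tendsto (fun t => D t ω o) atTop (𝓝 (Dlim ω o)))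
    {j : Fin K} (hj : j ≠ 0) :
    Tendsto (fun t => P.real {ω | I t ω = j}) atTop (𝓝 0) := by
  have h := tendsto_integral_of_dominated_convergence (μ := P)
    (F := fun t => P⟦{ω | I t ω = j} | ℱ t⟧) (f := fun _ => 0) (fun _ => (1 : ℝ))
    (fun t => (stronglyMeasurable_condExp.mono (ℱ.le t)).aestronglyMeasurable)
    (integrable_const 1) (fun t => ?_) (hplay.ae_tendsto_condProb_arm hn hφ hAL hconv hj)
  · simp_rw [integral_condExp (ℱ.le _)] at h
    rw [integral_zero] at h
    refine h.congr fun t => ?_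
    rw [integral_indicator_const _ (hplay.measurableSet_arm' t j), smul_eq_mul, mul_one]
  · filter_upwards [ae_condProb_arm_nonneg (P := P) (I := I) (ℱ := ℱ) t j,
      hplay.ae_condProb_arm_le MeasurableSet.univ t (j := j) fun _ _ => trivial] with ω h1 h2
    rw [Real.norm_of_nonneg h1]
    exact h2.trans measureReal_le_one

end IsThompsonPlay

end Play

end DuelingTS

theorem corollary1 {K n : ℕ} [NeZero K] (hn : 0 < n)
    (φ : Fin K → Fin K → ℝ) (hφ : DuelingTS.IsPreference φ)
    (hAL : DuelingTS.ApproximateLinearity φ)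
    {Ω : Type*} [mΩ : MeasurableSpace Ω] (P : Measure Ω) [IsProbabilityMeasure P]
    (ℱ : Filtration ℕ mΩ) (θ : ℕ → Ω → Fin K → ℝ) (I : ℕ → Ω → Fin K)
    (O : ℕ → Ω → Fin n → Fin K) (X : ℕ → Ω → Fin n → Bool)
    (D : ℕ → Ω → PMF (Fin n → Fin K))
    (hplay : DuelingTS.IsThompsonPlay P φ ℱ θ I O X D)
    (Dlim : Ω → PMF (Fin n → Fin K))
    (hconv : ∀ᵐ ω ∂P, ∀ o, Tendsto (fun t => D t ω o) atTop (𝓝 (Dlim ω o))) :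
    Tendsto (fun t => P {ω | I t ω = 0}) atTop (𝓝 1) := by
  have hsum : ∀ t, 1 - ∑ j ∈ Finset.univ.erase 0, P.real {ω | I t ω = j} =
      P.real {ω | I t ω = 0} := fun t => by
    have h1 : ∑ j, P.real (I t ⁻¹' {j}) = P.real (I t ⁻¹' ↑(Finset.univ : Finset (Fin K))) :=
      sum_measureReal_preimage_singleton _ fun j _ => hplay.measurableSet_arm' t j
    rw [Finset.coe_univ, Set.preimage_univ, probReal_univ,
      ← Finset.add_sum_erase _ _ (Finset.mem_univ 0)] at h1
    rw [← h1]
    exact add_sub_cancel_right _ _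
  have hlim := tendsto_finsetSum (Finset.univ.erase 0) fun j hj =>
    hplay.tendsto_measureReal_arm hn hφ hAL hconv (Finset.ne_of_mem_erase hj)
  have h1 := hlim.const_sub 1
  rw [Finset.sum_const_zero, sub_zero] at h1
  simp_rw [hsum] at h1
  have h2 := (ENNReal.tendsto_ofReal h1)
  simpa only [measureReal_def, ENNReal.ofReal_toReal (measure_ne_top P _), ENNReal.ofReal_one]
    using h2
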